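/- For positive integers $n,d$, let $G(n,d)$ be the random multigraph generated by the configuration model: take $n$ nodes with $d$ legs emanating from each node, and take a uniform random perfect matching of the $dn$ legs, each matched pair of legs becoming an edge between their nodes (if $dn$ is odd, first leave out one leg, chosen in an arbitrary, possibly random, way). Let $G(n,d)^{\mathrm{simp}}$ be its underlying simple graph (loops are deleted, parallel edges are merged). Let $\epsilon>0$, let $d_n\ge 1$ be integers with $d_n=O(n^{1-\epsilon})$, and let the random graph $G_n$ have the distribution of $G(n,d_n)^{\mathrm{simp}}$. Then, for any joint distribution of the $G_n$ (that is, for any random graphs $G_n$ with these distributions defined on a common probability space), the following hold almost surely: (0) all degrees in $G_n$ are at most $d_n$, for every $n$ (so that $(G_n,d_n)$ is an admissible sequence); (1) the sequence $(G_n,d_n)$ is $1$-regular: the degree of a uniform random vertex of $G_n$, divided by $d_n$, tends to $1$ in probability as $n\to\infty$, i.e. for every $\delta>0$ the proportion of the vertices $v$ of $G_n$ with $|\deg_{G_n}(v)/d_n-1|>\delta$ tends to $0$; (2) the sequence $(G_n,d_n)$ has large essential girth: for every $k\ge 3$, $$t_{\mathrm{inj}}(C_k,G_n,d_n)=\frac{\mathrm{inj}(C_k,G_n)}{n\,d_n(d_n-1)^{k-2}}\to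 0\qquad(n\to\infty),$$ where $C_k$ is the cycle on $k$ nodes, $\mathrm{inj}(C_k,G_n)$ is the number of injective homomorphisms $C_k\to G_n$, and the quotient is read as $0$ if $d_n=1$ (in which case $\mathrm{inj}(C_k,G_n)=0$). -/

import Mathlib

open MeasureTheory ProbabilityTheory Filter Topology Asymptotics

namespace GraphSeq

section Densities

/-- `(G, d)` is an admissible pair: `d ≥ 1` and all degrees of the finite simple graph `G` are
at most `d`. -/
def Admissible {V : Type*} [Finite V] (G : SimpleGraph V) (d : ℕ) : Prop :=
  1 ≤ d ∧ ∀ v, (G.neighborSet v).ncard ≤ d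

/-- The injective homomorphism density
`t_inj(F, G, d) = inj(F, G) / (v(G) * d * (d - 1) ^ (v(F) - 2))` of a connected graph `F` in an
admissible pair `(G, d)`; it is `1` if `F` is a single point. Here `G.labelledCopyCount F` is the
number of injective homomorphisms `F → G`. (If `d = 1` and `v(F) ≥ 3`, then there is no injective
homomorphism, and the value of the formula is `0`.) -/
noncomputable def injDensity {V W : Type*} [Fintype V] [Fintype W]
    (F : SimpleGraph W) (G : SimpleGraph V) (d : ℕ) : ℝ :=
  if Fintype.card W = 1 then 1
  else (G.labelledCopyCount F : ℝ) /
    ((Fintype.card V : ℝ) * (d : ℝ) * ((d : ℝ) - 1) ^ (Fintype.card W - 2))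

/-- The sequence `(G n, d n)` is `α`-regular: the degree of a uniform random vertex of `G n`,
divided by `d n`, tends to `α` in probability. -/
def IsRegularSeq (α : ℝ) {V : ℕ → Type*} [∀ n, Fintype (V n)]
    (G : ∀ n, SimpleGraph (V n)) (d : ℕ → ℕ) : Prop :=
  ∀ δ : ℝ, 0 < δ →
    Tendsto (fun n ↦
      ({v : V n | δ < |(((G n).neighborSet v).ncard : ℝ) / (d n : ℝ) - α|}.ncard : ℝ) /
        (Fintype.card (V n) : ℝ)) atTop (𝓝 0)

/-- The sequence `(G n, d n)` has large essential girth: `t_inj(C_k, G n, d n) → 0` for every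
`k ≥ 3`. -/
def HasLargeEssentialGirth {V : ℕ → Type*} [∀ n, Fintype (V n)]
    (G : ∀ n, SimpleGraph (V n)) (d : ℕ → ℕ) : Prop :=
  ∀ k : ℕ, 3 ≤ k →
    Tendsto (fun n ↦ injDensity (SimpleGraph.cycleGraph k) (G n) (d n)) atTop (𝓝 0)

end Densities

section ConfigurationModel

/-- The legs: `d` of them emanate from each of the `n` nodes, `(v, i)` being the `i`-th leg
of `v`. -/
abbrev Leg (n d : ℕ) : Type := Fin n × Fin d

/-- The perfect matchings of the legs outside `S`, a matching being encoded by the involution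
that sends each matched leg to its partner and fixes exactly the legs in `S`. -/
def legMatchings (n d : ℕ) (S : Finset (Leg n d)) : Set (Leg n d → Leg n d) :=
  {f | Function.Involutive f ∧ ∀ x, f x = x ↔ x ∈ S}

/-- The law of the random matching of the legs in the configuration model: choose the set `S` of
legs to be left out with law `ν`, and then a uniform random perfect matching of all other legs. -/
noncomputable def configurationLaw (n d : ℕ) (ν : PMF (Finset (Leg n d))) :
    Measure (Leg n d → Leg n d) :=
  ∑ S, ν S • uniformOn (legMatchings n d S)

/-- `ν` is an admissible way of leaving out legs: no leg is left out if the number `n * d` of legs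
is even, and exactly one leg (chosen in any way, possibly at random) if `n * d` is odd. -/
def LeavesOutParity {n d : ℕ} (ν : PMF (Finset (Leg n d))) : Prop :=
  ∀ S ∈ ν.support, S.card = (n * d) % 2

/-- The underlying simple graph of the multigraph given by a matching `f` of the legs. That
multigraph has one edge between the nodes of `x` and `f x` for every matched pair `{x, f x}` of
legs; here loops are discarded and parallel edges are merged, so that distinct nodes `u` and `v`
are adjacent if and only if some leg of `u` is matched with some leg of `v`. -/
def simpleGraphOf {n d : ℕ} (f : Leg n d → Leg n d) : SimpleGraph (Fin n) :=
  SimpleGraph.fromRel fun u v ↦ ∃ i j, f (u, i) = (v, j)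

/-- The law of the simplified configuration model `G(n, d)^simp`, where the legs to be left out
are chosen with law `ν`. -/
noncomputable def simpleConfigurationLaw (n d : ℕ) (ν : PMF (Finset (Leg n d))) :
    Measure (SimpleGraph (Fin n)) :=
  (configurationLaw n d ν).map simpleGraphOf

end ConfigurationModel

end GraphSeq

/-! In a uniform random matching of the `nd` legs, `r` prescribed disjoint pairs are all present
with probability at most `(C / (nd)) ^ r`: conjugating with a transposition redirects the partner of
a leg `a` from `b` to any other free leg, so no partner of `a` is much likelier than the others.

Loops, pairs of parallel edges and `k`-cycles of the simple graph are closed trails of `1`, `2` and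
`k` steps in the multigraph. Only `O(d ^ (k - 1))` closed trails of `k` steps meet a given bounded
set of legs, so a matching with at least `δ n d ^ (k - 1)` of them contains of the order of
`(δ n d ^ (k - 1)) ^ m` lists of `m` pairwise disjoint ones. On the other hand, there are at most
`(nd) ^ k d ^ k` possible closed trails of `k` steps, so the expected number of such lists is at
most `(C d ^ k) ^ m`. By Markov's inequality, having that many closed trails has probability at most
`(C d / (δ n)) ^ m = O(n ^ (-ε m))`, which is summable for `m > 1 / ε`; Borel-Cantelli concludes.
-/

namespace GraphSeq

open scoped Finset

section Matchings

variable {α : Type*}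

/-- The points covered by a list of pairs. A list of pairs `p` stands for a partial matching, and it
is a genuine one when `(endpoints p).Nodup`. -/
def endpoints (p : List (α × α)) : List α := p.flatMap fun e ↦ [e.1, e.2]

/-- The partial matching `p` is part of the matching `f`. -/
def ContainsPairs (f : α → α) (p : List (α × α)) : Prop := ∀ e ∈ p, f e.1 = e.2

instance [DecidableEq α] (f : α → α) : DecidablePred (ContainsPairs f) :=
  fun p ↦ inferInstanceAs (Decidable (∀ e ∈ p, f e.1 = e.2))

lemma containsPairs_cons {f : α → α} {e : α × α} {p : List (α × α)} :
    ContainsPairs f (e :: p) ↔ f e.1 = e.2 ∧ ContainsPairs f p :=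
  List.forall_mem_cons

lemma containsPairs_append {f : α → α} {p q : List (α × α)} :
    ContainsPairs f (p ++ q) ↔ ContainsPairs f p ∧ ContainsPairs f q :=
  List.forall_mem_append

lemma mem_endpoints {p : List (α × α)} {x : α} : x ∈ endpoints p ↔ ∃ e ∈ p, x = e.1 ∨ x = e.2 := by
  simp [endpoints]

lemma endpoints_cons (e : α × α) (p : List (α × α)) :
    endpoints (e :: p) = e.1 :: e.2 :: endpoints p := rfl

lemma endpoints_append (p q : List (α × α)) : endpoints (p ++ q) = endpoints p ++ endpoints q :=
  List.flatMap_append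

lemma length_endpoints (p : List (α × α)) : (endpoints p).length = 2 * p.length := by
  simp [endpoints, mul_comm]

lemma mem_endpoints_of_apply_mem {f : α → α} (hf : Function.Involutive f) {p : List (α × α)}
    (hp : ContainsPairs f p) {x : α} (hx : f x ∈ endpoints p) : x ∈ endpoints p := by
  obtain ⟨e, he, h | h⟩ := mem_endpoints.1 hx
  · exact mem_endpoints.2 ⟨e, he, .inr (by rw [← hp e he, ← h, hf])⟩
  · exact mem_endpoints.2 ⟨e, he, .inl (hf.injective (h.trans (hp e he).symm))⟩

variable [DecidableEq α]

lemma card_mul_le_sum_card_append {A : Finset (α → α)} {C : Finset (List (α × α))}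
    {p : List (α × α)} {D : ℝ}
    (hD : ∀ f ∈ A, ContainsPairs f p →
      D ≤ #{c ∈ C | Disjoint (endpoints c).toFinset (endpoints p).toFinset ∧ ContainsPairs f c}) :
    #{f ∈ A | ContainsPairs f p} * D ≤
      ∑ c ∈ C with Disjoint (endpoints c).toFinset (endpoints p).toFinset,
        (#{f ∈ A | ContainsPairs f (c ++ p)} : ℝ) := by
  set A' := {f ∈ A | ContainsPairs f p} with hA'
  set C' := {c ∈ C | Disjoint (endpoints c).toFinset (endpoints p).toFinset} with hC'
  calc #A' * D ≤ ∑ f ∈ A', (#{c ∈ C' | ContainsPairs f c} : ℝ) := by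
        rw [← nsmul_eq_mul]
        refine Finset.card_nsmul_le_sum _ _ _ fun f hf ↦ ?_
        rw [hC', Finset.filter_filter]
        exact hD f (Finset.mem_filter.1 hf).1 (Finset.mem_filter.1 hf).2
    _ = ∑ c ∈ C', (#{f ∈ A' | ContainsPairs f c} : ℝ) :=
        mod_cast Finset.sum_card_bipartiteAbove_eq_sum_card_bipartiteBelow ContainsPairs
    _ = ∑ c ∈ C', (#{f ∈ A | ContainsPairs f (c ++ p)} : ℝ) := by
        simp only [hA', Finset.filter_filter, containsPairs_append, and_comm]

variable [Fintype α] {S : Finset α} {f : α → α}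

/-- The perfect matchings of the complement of `S`, encoded as in `legMatchings`. -/
def matchings (S : Finset α) : Finset (α → α) :=
  {f | (∀ x, f (f x) = x) ∧ ∀ x, f x = x ↔ x ∈ S}

lemma mem_matchings : f ∈ matchings S ↔ Function.Involutive f ∧ ∀ x, f x = x ↔ x ∈ S := by
  simp [matchings, Function.Involutive]

/-- The perfect matchings of the complement of `S` that contain the partial matching `p`. -/
def matchingsContaining (S : Finset α) (p : List (α × α)) : Finset (α → α) :=
  {f ∈ matchings S | ContainsPairs f p}

lemma mem_matchingsContaining_cons {a b : α} {p : List (α × α)} :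
    f ∈ matchingsContaining S ((a, b) :: p) ↔ f ∈ matchingsContaining S p ∧ f a = b := by
  simp only [matchingsContaining, Finset.mem_filter, containsPairs_cons]
  tauto

lemma arrowCongr_mem_matchings {σ : Equiv.Perm α} (hσ : ∀ x, σ x ∈ S ↔ x ∈ S)
    (hf : f ∈ matchings S) : σ.arrowCongr σ f ∈ matchings S := by
  obtain ⟨hinv, hfix⟩ := mem_matchings.1 hf
  refine mem_matchings.2 ⟨fun x ↦ by simp [hinv _], fun x ↦ ?_⟩
  rw [← σ.apply_symm_apply x, hσ, ← hfix]
  simp [← σ.eq_symm_apply]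

/-- Conjugating with the transposition of `b` and `b'` redirects the partner of `a`. -/
lemma card_matchingsContaining_cons_le_cons {p : List (α × α)} {a b b' : α}
    (hnd : (endpoints ((a, b) :: p)).Nodup) (hab' : a ≠ b') (hb' : b' ∉ S)
    (hbp' : b' ∉ endpoints p) :
    #(matchingsContaining S ((a, b) :: p)) ≤ #(matchingsContaining S ((a, b') :: p)) := by
  simp only [endpoints_cons, List.nodup_cons, List.mem_cons, not_or] at hnd
  obtain ⟨⟨hab, -⟩, hbp, -⟩ := hnd
  set σ := Equiv.swap b b' with hσ
  refine Finset.card_le_card_of_injOn (σ.arrowCongr σ) (fun f hf ↦ ?_)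
    (σ.arrowCongr σ).injective.injOn
  rw [Finset.mem_coe, mem_matchingsContaining_cons, matchingsContaining, Finset.mem_filter] at hf ⊢
  obtain ⟨⟨hfS, hfp⟩, hfa⟩ := hf
  have hb : b ∉ S := by
    obtain ⟨hinv, hfix⟩ := mem_matchings.1 hfS
    rw [← hfix, ← hfa, hinv]
    exact fun h ↦ hab (h.trans hfa)
  have hσ_fix : ∀ x ∈ endpoints p, σ x = x := fun x hx ↦
    Equiv.swap_apply_of_ne_of_ne (ne_of_mem_of_not_mem hx hbp) (ne_of_mem_of_not_mem hx hbp')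
  have hσ_S : ∀ x, σ x ∈ S ↔ x ∈ S := fun x ↦ by
    rw [hσ, Equiv.swap_apply_def]; split_ifs <;> simp_all
  refine ⟨⟨arrowCongr_mem_matchings hσ_S hfS, fun e he ↦ ?_⟩, ?_⟩
  · have h₁ := hσ_fix e.1 (mem_endpoints.2 ⟨e, he, .inl rfl⟩)
    have h₂ := hσ_fix e.2 (mem_endpoints.2 ⟨e, he, .inr rfl⟩)
    simp [σ.symm_apply_eq.2 h₁.symm, hfp e he, h₂]
  · have h : σ.symm a = a := σ.symm_apply_eq.2 (Equiv.swap_apply_of_ne_of_ne hab hab').symm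
    calc σ.arrowCongr σ f a = σ b := by simp [h, hfa]
      _ = b' := Equiv.swap_apply_left b b'

lemma mul_card_matchingsContaining_cons_le {p : List (α × α)} {a b : α}
    (hnd : (endpoints ((a, b) :: p)).Nodup) {Q : ℕ}
    (hQ : Q + (#S + 2 * p.length + 1) ≤ Fintype.card α) :
    Q * #(matchingsContaining S ((a, b) :: p)) ≤ #(matchingsContaining S p) := by
  set excluded : Finset α := insert a (S ∪ (endpoints p).toFinset) with hexcluded
  have hQ_le : Q ≤ #excludedᶜ := by
    have hle : #excluded ≤ #S + 2 * p.length + 1 := calc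
      #excluded ≤ #(S ∪ (endpoints p).toFinset) + 1 := Finset.card_insert_le _ _
      _ ≤ #S + #(endpoints p).toFinset + 1 := by gcongr; exact Finset.card_union_le _ _
      _ ≤ #S + 2 * p.length + 1 := by
        gcongr; exact (List.toFinset_card_le _).trans_eq (length_endpoints p)
    rw [Finset.card_compl]
    omega
  calc Q * #(matchingsContaining S ((a, b) :: p))
      ≤ #excludedᶜ * #(matchingsContaining S ((a, b) :: p)) := by gcongr
    _ ≤ ∑ b' ∈ excludedᶜ, #(matchingsContaining S ((a, b') :: p)) := by
        rw [← smul_eq_mul]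
        refine Finset.card_nsmul_le_sum _ _ _ fun b' hb' ↦ ?_
        simp only [hexcluded, Finset.mem_compl, Finset.mem_insert, Finset.mem_union,
          List.mem_toFinset, not_or] at hb'
        exact card_matchingsContaining_cons_le_cons hnd (Ne.symm hb'.1) hb'.2.1 hb'.2.2
    _ ≤ ∑ b', #{f ∈ matchingsContaining S p | f a = b'} := by
        refine (Finset.sum_le_sum_of_subset (Finset.subset_univ _)).trans_eq ?_
        refine Finset.sum_congr rfl fun b' _ ↦ congrArg Finset.card ?_
        ext f
        rw [mem_matchingsContaining_cons, Finset.mem_filter]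
    _ = #(matchingsContaining S p) :=
        (Finset.card_eq_sum_card_fiberwise fun _ _ ↦ Finset.mem_coe.2 (Finset.mem_univ _)).symm

lemma pow_mul_card_matchingsContaining_le {p : List (α × α)} (hnd : (endpoints p).Nodup) {Q : ℕ}
    (hQ : Q + (#S + 2 * p.length) ≤ Fintype.card α) :
    Q ^ p.length * #(matchingsContaining S p) ≤ #(matchings S) := by
  induction p with
  | nil => simp [matchingsContaining, ContainsPairs]
  | cons e p ih =>
    rw [List.length_cons] at hQ ⊢
    have htail : (endpoints p).Nodup := (List.nodup_cons.1 (List.nodup_cons.1 hnd).2).2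
    calc Q ^ (p.length + 1) * #(matchingsContaining S (e :: p))
        = Q ^ p.length * (Q * #(matchingsContaining S (e :: p))) := by ring
      _ ≤ Q ^ p.length * #(matchingsContaining S p) := by
          gcongr; exact mul_card_matchingsContaining_cons_le hnd (by omega)
      _ ≤ #(matchings S) := ih htail (by omega)

/-- The `m`-th moment method: each matching in `A` contains, one after the other, `m` pairwise
disjoint members of `C`, with at least `D` choices every time. -/
lemma card_mul_pow_le_of_many_disjoint {A : Finset (α → α)} (hA : A ⊆ matchings S)
    {C : Finset (List (α × α))} {r : ℕ} (hr : ∀ c ∈ C, c.length = r)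
    (hnd : ∀ c ∈ C, (endpoints c).Nodup) {K Q : ℕ} (hQ : Q + (#S + 2 * K) ≤ Fintype.card α)
    {D : ℝ} (hD0 : 0 ≤ D)
    (hD : ∀ f ∈ A, ∀ p, ContainsPairs f p → p.length ≤ K →
      D ≤ #{c ∈ C | Disjoint (endpoints c).toFinset (endpoints p).toFinset ∧ ContainsPairs f c})
    (m : ℕ) {p : List (α × α)} (hp : (endpoints p).Nodup) (hpK : p.length + r * m ≤ K) :
    #{f ∈ A | ContainsPairs f p} * (D ^ m * (Q : ℝ) ^ (p.length + r * m)) ≤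
      (#C : ℝ) ^ m * #(matchings S) := by
  induction m generalizing p with
  | zero =>
    have hsub : #{f ∈ A | ContainsPairs f p} ≤ #(matchingsContaining S p) :=
      Finset.card_le_card (Finset.filter_subset_filter _ hA)
    have hle := pow_mul_card_matchingsContaining_le (S := S) (Q := Q) hp (by omega)
    calc _ = (#{f ∈ A | ContainsPairs f p} : ℝ) * Q ^ p.length := by simp
      _ ≤ #(matchingsContaining S p) * (Q : ℝ) ^ p.length := by gcongr
      _ ≤ _ := by rw [mul_comm, pow_zero, one_mul]; exact_mod_cast hle
  | succ m ih =>
    set C' := {c ∈ C | Disjoint (endpoints c).toFinset (endpoints p).toFinset}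
    have hstep := card_mul_le_sum_card_append (C := C) (p := p)
      fun f hf hfp ↦ hD f hf p hfp (by omega)
    calc _ = #{f ∈ A | ContainsPairs f p} * D * (D ^ m * (Q : ℝ) ^ (p.length + r * (m + 1))) := by
          ring
      _ ≤ (∑ c ∈ C', (#{f ∈ A | ContainsPairs f (c ++ p)} : ℝ)) *
              (D ^ m * (Q : ℝ) ^ (p.length + r * (m + 1))) := by gcongr
      _ ≤ ∑ _ ∈ C', (#C : ℝ) ^ m * #(matchings S) := by
          rw [Finset.sum_mul]
          refine Finset.sum_le_sum fun c hc ↦ ?_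
          obtain ⟨hcC, hdisj⟩ := Finset.mem_filter.1 hc
          have hlen : (c ++ p).length + r * m = p.length + r * (m + 1) := by
            rw [List.length_append, hr c hcC]; ring
          have hcp : (endpoints (c ++ p)).Nodup := by
            rw [endpoints_append]
            exact (hnd c hcC).append hp (List.disjoint_toFinset_iff_disjoint.1 hdisj)
          simpa only [hlen] using ih hcp (by omega)
      _ ≤ #C * ((#C : ℝ) ^ m * #(matchings S)) := by
          rw [Finset.sum_const, nsmul_eq_mul]
          gcongr
          exact Finset.filter_subset _ _
      _ = _ := by ring

end Matchings

section ClosedTrails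

variable {n d k : ℕ} {f : Leg n d → Leg n d} {s : Fin (k + 1) → Leg n d}

/-- The closed walks of `k + 1` steps in the multigraph of the matching `f`. A walk is recorded by
the legs through which it leaves its nodes, with indices modulo `k + 1`. -/
def closedWalks (f : Leg n d → Leg n d) (k : ℕ) : Finset (Fin (k + 1) → Leg n d) :=
  {s | ∀ i, (f (s i)).1 = (s (i + 1)).1}

/-- The closed walks of `k + 1` steps that use no edge twice: loops for `k = 0`, pairs of parallel
edges for `k = 1`, and in particular all cycles for `k ≥ 2`. -/
def closedTrails (f : Leg n d → Leg n d) (k : ℕ) : Finset (Fin (k + 1) → Leg n d) :=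
  {s ∈ closedWalks f k | Function.Injective s ∧ ∀ i j, f (s i) ≠ s j}

lemma mem_closedWalks : s ∈ closedWalks f k ↔ ∀ i, (f (s i)).1 = (s (i + 1)).1 := by
  simp [closedWalks]

lemma mem_closedTrails :
    s ∈ closedTrails f k ↔
      s ∈ closedWalks f k ∧ Function.Injective s ∧ ∀ i j, f (s i) ≠ s j := by
  simp [closedTrails]

open Fin.CommRing in
lemma closedWalks_ext {s' : Fin (k + 1) → Leg n d} (hs : s ∈ closedWalks f k)
    (hs' : s' ∈ closedWalks f k) {i : Fin (k + 1)} (hi : s i = s' i)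
    (hslot : ∀ j, (s j).2 = (s' j).2) : s = s' := by
  rw [mem_closedWalks] at hs hs'
  have hshift : ∀ j : ℕ, s (i + (j : Fin (k + 1))) = s' (i + (j : Fin (k + 1))) := by
    intro j
    induction j with
    | zero => simpa using hi
    | succ j ih =>
      refine Prod.ext ?_ (hslot _)
      rw [Nat.cast_succ, ← add_assoc, ← hs, ← hs', ih]
  funext l
  simpa using hshift (l - i : Fin (k + 1)).val

lemma card_closedWalks_through_leg_le (f : Leg n d → Leg n d) (i : Fin (k + 1)) (x : Leg n d) :
    #{s ∈ closedWalks f k | s i = x} ≤ d ^ k := by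
  calc #{s ∈ closedWalks f k | s i = x} ≤ #(Finset.univ : Finset (Fin k → Fin d)) := by
        refine Finset.card_le_card_of_injOn (fun s j ↦ (s (i.succAbove j)).2)
          (fun _ _ ↦ Finset.mem_coe.2 (Finset.mem_univ _)) fun s hs s' hs' hslot ↦ ?_
        obtain ⟨hs, hsi⟩ := Finset.mem_filter.1 hs
        obtain ⟨hs', hsi'⟩ := Finset.mem_filter.1 hs'
        refine closedWalks_ext hs hs' (hsi.trans hsi'.symm) fun j ↦ ?_
        rcases Fin.eq_self_or_eq_succAbove i j with rfl | ⟨l, rfl⟩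
        · rw [hsi, hsi']
        · exact congrFun hslot l
    _ = d ^ k := by simp

lemma card_closedWalks_meeting_le (f : Leg n d → Leg n d) (k : ℕ) (Z : Finset (Leg n d)) :
    #{s ∈ closedWalks f k | ∃ i, s i ∈ Z} ≤ (k + 1) * #Z * d ^ k := by
  calc #{s ∈ closedWalks f k | ∃ i, s i ∈ Z}
      ≤ #((Finset.univ ×ˢ Z).biUnion fun ix ↦ {s ∈ closedWalks f k | s ix.1 = ix.2}) := by
        refine Finset.card_le_card fun s hs ↦ ?_
        obtain ⟨hs, i, hi⟩ := Finset.mem_filter.1 hs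
        exact Finset.mem_biUnion.2 ⟨(i, s i), by simp [hi], by simp [hs]⟩
    _ ≤ #(Finset.univ ×ˢ Z) * d ^ k :=
        Finset.card_biUnion_le_card_mul _ _ _ fun ix _ ↦ card_closedWalks_through_leg_le f ix.1 ix.2
    _ = (k + 1) * #Z * d ^ k := by simp

/-- The edges used by a walk, as a partial matching. -/
def steps (f : Leg n d → Leg n d) (s : Fin (k + 1) → Leg n d) : List (Leg n d × Leg n d) :=
  List.ofFn fun i ↦ (s i, f (s i))

/-- The partial matchings that can be the list of steps of a closed trail of `k + 1` steps. -/
def trailPatterns (n d k : ℕ) : Finset (List (Leg n d × Leg n d)) :=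
  (Finset.univ.image fun st : (Fin (k + 1) → Leg n d) × (Fin (k + 1) → Fin d) ↦
    List.ofFn fun i ↦ (st.1 i, ((st.1 (i + 1)).1, st.2 i))).filter fun p ↦ (endpoints p).Nodup

lemma card_trailPatterns_le (n d k : ℕ) :
    #(trailPatterns n d k) ≤ (n * d) ^ (k + 1) * d ^ (k + 1) := by
  refine (Finset.card_filter_le _ _).trans (Finset.card_image_le.trans_eq ?_)
  simp

lemma length_of_mem_trailPatterns {p : List (Leg n d × Leg n d)} (hp : p ∈ trailPatterns n d k) :
    p.length = k + 1 := by
  obtain ⟨st, -, rfl⟩ := Finset.mem_image.1 (Finset.mem_filter.1 hp).1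
  exact List.length_ofFn

lemma nodup_endpoints_of_mem_trailPatterns {p : List (Leg n d × Leg n d)}
    (hp : p ∈ trailPatterns n d k) : (endpoints p).Nodup :=
  (Finset.mem_filter.1 hp).2

lemma steps_injective (f : Leg n d → Leg n d) :
    Function.Injective (steps f : (Fin (k + 1) → Leg n d) → _) := fun s s' h ↦ by
  funext i
  exact congrArg Prod.fst (congrFun (List.ofFn_injective h) i)

lemma containsPairs_steps (f : Leg n d → Leg n d) (s : Fin (k + 1) → Leg n d) :
    ContainsPairs f (steps f s) := by
  simp [ContainsPairs, steps]

lemma nodup_endpoints_steps (hf : Function.Involutive f) (hs : s ∈ closedTrails f k) :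
    (endpoints (steps f s)).Nodup := by
  obtain ⟨-, hinj, hne⟩ := mem_closedTrails.1 hs
  rw [endpoints, List.nodup_flatMap, steps, List.pairwise_ofFn]
  refine ⟨List.forall_mem_ofFn_iff.2 fun i ↦ by simpa using (hne i i).symm, fun i j hij ↦ ?_⟩
  have h : s j ≠ s i := hinj.ne hij.ne'
  simp [Function.onFun, h, (hne i j).symm, hne j i, hf.injective.ne h]

lemma steps_mem_trailPatterns (hf : Function.Involutive f) (hs : s ∈ closedTrails f k) :
    steps f s ∈ trailPatterns n d k := by
  have hwalk := mem_closedWalks.1 (mem_closedTrails.1 hs).1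
  refine Finset.mem_filter.2 ⟨Finset.mem_image.2 ⟨(s, fun i ↦ (f (s i)).2), Finset.mem_univ _, ?_⟩,
    nodup_endpoints_steps hf hs⟩
  simp [steps, ← hwalk]

lemma card_closedTrails_le_card_disjoint_add (hf : Function.Involutive f)
    {p : List (Leg n d × Leg n d)} (hp : ContainsPairs f p) (k : ℕ) :
    #(closedTrails f k) ≤ #{c ∈ trailPatterns n d k |
      Disjoint (endpoints c).toFinset (endpoints p).toFinset ∧ ContainsPairs f c} +
        (k + 1) * (2 * p.length) * d ^ k := by
  rw [← Finset.card_filter_add_card_filter_not fun s ↦ ∃ i, s i ∈ (endpoints p).toFinset, add_comm]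
  refine add_le_add ?_ ?_
  · refine Finset.card_le_card_of_injOn (steps f) (fun s hs ↦ ?_) (steps_injective f).injOn
    obtain ⟨hs, havoid⟩ := Finset.mem_filter.1 hs
    simp only [List.mem_toFinset, not_exists] at havoid
    refine Finset.mem_filter.2 ⟨steps_mem_trailPatterns hf hs,
      List.disjoint_toFinset_iff_disjoint.2 fun x hx hxp ↦ ?_, containsPairs_steps f s⟩
    obtain ⟨_, he, hx⟩ := mem_endpoints.1 hx
    obtain ⟨i, rfl⟩ := List.mem_ofFn.1 he
    rcases hx with rfl | rfl
    · exact havoid i hxp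
    · exact havoid i (mem_endpoints_of_apply_mem hf hp hxp)
  · calc _ ≤ #{s ∈ closedWalks f k | ∃ i, s i ∈ (endpoints p).toFinset} :=
          Finset.card_le_card (Finset.filter_subset_filter _ (Finset.filter_subset _ _))
      _ ≤ (k + 1) * #(endpoints p).toFinset * d ^ k := card_closedWalks_meeting_le f k _
      _ ≤ (k + 1) * (2 * p.length) * d ^ k := by
          gcongr
          exact (List.toFinset_card_le _).trans_eq (length_endpoints p)

lemma mul_pow_le_card_disjoint_patterns (hf : Function.Involutive f)
    {p : List (Leg n d × Leg n d)} (hp : ContainsPairs f p) {t : ℝ}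
    (ht : 2 * (k + 1) * p.length ≤ t) (hft : 2 * t * d ^ k ≤ #(closedTrails f k)) :
    t * d ^ k ≤ #{c ∈ trailPatterns n d k |
      Disjoint (endpoints c).toFinset (endpoints p).toFinset ∧ ContainsPairs f c} := by
  have hmeet : ((k + 1) * (2 * p.length) * d ^ k : ℝ) ≤ t * d ^ k := by
    gcongr
    linarith
  have hle : (#(closedTrails f k) : ℝ) ≤ _ :=
    Nat.cast_le.2 (card_closedTrails_le_card_disjoint_add hf hp k)
  push_cast at hle
  linarith

lemma card_many_closedTrails_mul_pow_le {S : Finset (Leg n d)} {t : ℝ} {m : ℕ} (hnd : 0 < n * d)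
    (hS : 2 * (#S + 2 * ((k + 1) * m)) ≤ n * d) (ht : 2 * (k + 1) * ((k + 1) * m) ≤ t) :
    #{f ∈ matchings S | 2 * t * d ^ k ≤ #(closedTrails f k)} * t ^ m ≤
      (2 ^ (k + 1) * d : ℝ) ^ m * #(matchings S) := by
  have ht0 : 0 ≤ t := ht.trans' (by positivity)
  have hn0 : (0 : ℝ) < n := mod_cast Nat.pos_of_mul_pos_right hnd
  have hd0 : (0 : ℝ) < d := mod_cast Nat.pos_of_mul_pos_left hnd
  obtain ⟨Q, hQ⟩ : ∃ Q, Q + (#S + 2 * ((k + 1) * m)) = n * d := ⟨_, Nat.sub_add_cancel (by omega)⟩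
  have hQ_ge : (n * d : ℝ) ≤ 2 * Q := by
    have : n * d ≤ 2 * Q := by omega
    exact_mod_cast this
  set A := {f ∈ matchings S | 2 * t * d ^ k ≤ #(closedTrails f k)}
  have hmany : ∀ f ∈ A, ∀ p, ContainsPairs f p → p.length ≤ (k + 1) * m →
      t * d ^ k ≤ #{c ∈ trailPatterns n d k |
        Disjoint (endpoints c).toFinset (endpoints p).toFinset ∧ ContainsPairs f c} := by
    intro f hf p hp hpK
    obtain ⟨hfS, hft⟩ := Finset.mem_filter.1 hf
    refine mul_pow_le_card_disjoint_patterns (mem_matchings.1 hfS).1 hp (ht.trans' ?_) hft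
    gcongr
    exact_mod_cast hpK
  have hcard : Q + (#S + 2 * ((k + 1) * m)) ≤ Fintype.card (Leg n d) := by simpa using hQ.le
  have hmoment := card_mul_pow_le_of_many_disjoint (p := []) (Finset.filter_subset _ _)
    (fun _ ↦ length_of_mem_trailPatterns) (fun _ ↦ nodup_endpoints_of_mem_trailPatterns) hcard
    (by positivity) hmany m (by simp [endpoints]) (by simp)
  have hA_nil : {f ∈ A | ContainsPairs f []} = A := by simp [ContainsPairs]
  rw [hA_nil, List.length_nil, zero_add] at hmoment
  refine le_of_mul_le_mul_right ?_ (by positivity : 0 < ((n * d : ℝ) ^ (k + 1) * d ^ k) ^ m)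
  calc #A * t ^ m * ((n * d : ℝ) ^ (k + 1) * d ^ k) ^ m
      ≤ #A * t ^ m * ((2 * Q) ^ (k + 1) * d ^ k) ^ m := by gcongr
    _ = 2 ^ ((k + 1) * m) * (#A * ((t * d ^ k) ^ m * Q ^ ((k + 1) * m))) := by
        ring
    _ ≤ 2 ^ ((k + 1) * m) * (#(trailPatterns n d k) ^ m * #(matchings S)) := by gcongr
    _ ≤ 2 ^ ((k + 1) * m) * (((n * d) ^ (k + 1) * d ^ (k + 1)) ^ m * #(matchings S)) := by
        gcongr; exact_mod_cast card_trailPatterns_le n d k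
    _ = (2 ^ (k + 1) * d) ^ m * #(matchings S) * ((n * d) ^ (k + 1) * d ^ k) ^ m := by
        ring

end ClosedTrails

section SimpleGraphOf

variable {n d : ℕ} {f : Leg n d → Leg n d}

lemma simpleGraphOf_adj (hf : Function.Involutive f) {u v : Fin n} :
    (simpleGraphOf f).Adj u v ↔ u ≠ v ∧ ∃ i, (f (u, i)).1 = v := by
  rw [simpleGraphOf, SimpleGraph.fromRel_adj]
  refine and_congr_right' ⟨?_, ?_⟩
  · rintro (⟨i, j, h⟩ | ⟨i, j, h⟩)
    · exact ⟨i, by rw [h]⟩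
    · exact ⟨j, by rw [← h, hf]⟩
  · rintro ⟨i, rfl⟩
    exact .inl ⟨i, (f (u, i)).2, rfl⟩

lemma ncard_neighborSet_simpleGraphOf_le (hf : Function.Involutive f) (u : Fin n) :
    ((simpleGraphOf f).neighborSet u).ncard ≤ d := by
  have hsub : (simpleGraphOf f).neighborSet u ⊆ (fun i ↦ (f (u, i)).1) '' Set.univ := fun v hv ↦ by
    simpa using ((simpleGraphOf_adj hf).1 hv).2
  calc ((simpleGraphOf f).neighborSet u).ncard ≤ (Set.univ : Set (Fin d)).ncard :=
        (Set.ncard_le_ncard hsub).trans Set.ncard_image_le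
    _ = d := by simp

lemma admissible_simpleGraphOf (hf : Function.Involutive f) (hd : 1 ≤ d) :
    Admissible (simpleGraphOf f) d :=
  ⟨hd, ncard_neighborSet_simpleGraphOf_le hf⟩

/-- The legs that do not contribute to the degree of their node in the simple graph: those that are
left out, those in a loop, and those parallel to an earlier leg. -/
def redundantLegs (f : Leg n d → Leg n d) : Finset (Leg n d) :=
  {x | (f x).1 = x.1 ∨ ∃ i < x.2, (f (x.1, i)).1 = (f x).1}

lemma le_ncard_neighborSet_add_card_redundantLegs (hf : Function.Involutive f) (u : Fin n) :
    d ≤ ((simpleGraphOf f).neighborSet u).ncard + #{x ∈ redundantLegs f | x.1 = u} := by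
  have hkept : #{i | (u, i) ∉ redundantLegs f} ≤ ((simpleGraphOf f).neighborSet u).ncard := by
    rw [← Set.ncard_coe_finset]
    refine Set.ncard_le_ncard_of_injOn (fun i ↦ (f (u, i)).1) (fun i hi ↦ ?_) fun i hi j hj hij ↦ ?_
    · simp only [redundantLegs, Finset.coe_filter, Finset.mem_univ, true_and, Set.mem_ofPred_eq,
        Finset.mem_filter, not_or] at hi
      exact (simpleGraphOf_adj hf).2 ⟨Ne.symm hi.1, i, rfl⟩
    · simp only [redundantLegs, Finset.coe_filter, Finset.mem_univ, true_and, Set.mem_ofPred_eq,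
        Finset.mem_filter, not_or, not_exists, not_and] at hi hj
      rcases lt_trichotomy i j with h | h | h
      · exact absurd hij (hj.2 i h)
      · exact h
      · exact absurd hij.symm (hi.2 j h)
  have hredundant : #{i | (u, i) ∈ redundantLegs f} ≤ #{x ∈ redundantLegs f | x.1 = u} :=
    Finset.card_le_card_of_injOn (Prod.mk u) (fun i hi ↦ by simpa using hi)
      (Prod.mk_right_injective u).injOn
  have hsplit := Finset.card_filter_add_card_filter_not (s := Finset.univ)
    fun i : Fin d ↦ (u, i) ∈ redundantLegs f
  rw [Finset.card_univ, Fintype.card_fin] at hsplit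
  omega

lemma card_loops_le (f : Leg n d → Leg n d) :
    #{x | (f x).1 = x.1 ∧ f x ≠ x} ≤ #(closedTrails f 0) := by
  refine Finset.card_le_card_of_surjOn (fun s ↦ s 0) fun x hx ↦ ⟨fun _ ↦ x, ?_, rfl⟩
  obtain ⟨-, hloop, hne⟩ := Finset.mem_filter.1 hx
  exact mem_closedTrails.2 ⟨mem_closedWalks.2 fun _ ↦ hloop,
    fun i j _ ↦ Subsingleton.elim (α := Fin 1) i j, fun _ _ ↦ hne⟩

lemma card_parallel_le (hf : Function.Involutive f) :
    #{x | (f x).1 ≠ x.1 ∧ ∃ i < x.2, (f (x.1, i)).1 = (f x).1} ≤ #(closedTrails f 1) := by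
  refine Finset.card_le_card_of_surjOn (fun s ↦ s 0) fun x hx ↦ ?_
  obtain ⟨-, hne, i, hi, hpar⟩ := Finset.mem_filter.1 hx
  set y : Leg n d := (x.1, i)
  have hyx : y ≠ x := fun h ↦ hi.ne (congrArg Prod.snd h)
  have hfx : f x ≠ x := fun h ↦ hne (congrArg Prod.fst h)
  have hfy : f y ≠ y := fun h ↦ hne (by rw [← hpar, h])
  have hfyx : f y ≠ x := fun h ↦ hne (by rw [← hpar, h])
  -- The trail leaves along `x` and returns along the earlier leg `y`.
  refine ⟨![x, f y], mem_closedTrails.2 ⟨mem_closedWalks.2 ?_, ?_, ?_⟩, rfl⟩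
  · exact Fin.forall_fin_two.2 ⟨hpar.symm, by simp [hf y, y]⟩
  · rw [← List.nodup_ofFn]
    simpa using hfyx.symm
  · simp [Fin.forall_fin_two, hf y, hyx, hfx, hfy.symm, hf.injective.ne hyx.symm]

lemma card_redundantLegs_le (hf : Function.Involutive f) :
    #(redundantLegs f) ≤ #{x | f x = x} + #(closedTrails f 0) + #(closedTrails f 1) := by
  refine le_trans (Finset.card_le_card fun x hx ↦ ?_) ((Finset.card_union_le _ _).trans
    (add_le_add ((Finset.card_union_le _ _).trans (add_le_add_right (card_loops_le f) _))
      (card_parallel_le hf)))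
  have := (Finset.mem_filter.1 hx).2
  simp only [Finset.mem_union, Finset.mem_filter, Finset.mem_univ, true_and]
  tauto

lemma ncard_irregular_mul_le (hf : Function.Involutive f) (hd : 1 ≤ d) (η : ℝ) :
    ({v | η < |(((simpleGraphOf f).neighborSet v).ncard : ℝ) / d - 1|}.ncard : ℝ) * (η * d) ≤
      #(redundantLegs f) := by
  obtain ⟨A, hA⟩ := (Set.toFinite
    {v | η < |(((simpleGraphOf f).neighborSet v).ncard : ℝ) / d - 1|}).exists_finset_coe
  have hd0 : (0 : ℝ) < d := mod_cast hd
  have hmany : ∀ v ∈ A, η * d ≤ #{x ∈ redundantLegs f | x.1 = v} := fun v hv ↦ by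
    rw [← Finset.mem_coe, hA, Set.mem_ofPred_eq, abs_sub_comm] at hv
    have hle : (((simpleGraphOf f).neighborSet v).ncard : ℝ) / d ≤ 1 :=
      (div_le_one hd0).2 (mod_cast ncard_neighborSet_simpleGraphOf_le hf v)
    have hge : (d : ℝ) ≤
        ((simpleGraphOf f).neighborSet v).ncard + #{x ∈ redundantLegs f | x.1 = v} :=
      mod_cast le_ncard_neighborSet_add_card_redundantLegs hf v
    rw [abs_of_nonneg (sub_nonneg.2 hle), lt_sub_comm, div_lt_iff₀ hd0] at hv
    linarith
  rw [← hA, Set.ncard_coe_finset, ← nsmul_eq_mul]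
  calc #A • (η * d) ≤ ∑ v ∈ A, (#{x ∈ redundantLegs f | x.1 = v} : ℝ) :=
        Finset.card_nsmul_le_sum _ _ _ hmany
    _ = #{x ∈ redundantLegs f | x.1 ∈ A} := mod_cast Finset.sum_card_fiberwise_eq_card_filter _ _ _
    _ ≤ #(redundantLegs f) := mod_cast Finset.card_filter_le _ _

lemma add_one_add_one_ne_self {k : ℕ} (hk : 2 ≤ k) (i : Fin (k + 1)) : i + 1 + 1 ≠ i := by
  intro h
  rw [add_assoc, add_eq_left] at h
  have hval := congrArg Fin.val h
  rw [Fin.val_add, Fin.val_one', Nat.mod_eq_of_lt (by omega : 1 < k + 1),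
    Nat.mod_eq_of_lt (by omega)] at hval
  simp at hval

lemma exists_closedTrail_of_copy (hf : Function.Involutive f) {k : ℕ} (hk : 2 ≤ k)
    (φ : SimpleGraph.Copy (SimpleGraph.cycleGraph (k + 1)) (simpleGraphOf f)) :
    ∃ s ∈ closedTrails f k, ∀ i, (s i).1 = φ i := by
  have hadj : ∀ i : Fin (k + 1), ∃ j, (f (φ i, j)).1 = φ (i + 1) := fun i ↦ by
    have h : (SimpleGraph.cycleGraph (k + 1)).Adj i (i + 1) := by
      rw [SimpleGraph.cycleGraph_adj', add_sub_cancel_left, Fin.val_one',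
        Nat.mod_eq_of_lt (by omega)]
      exact .inr rfl
    exact ((simpleGraphOf_adj hf).1 (φ.toHom.map_adj h)).2
  choose slot hslot using hadj
  have hφ : Function.Injective φ := φ.injective
  refine ⟨fun i ↦ (φ i, slot i), mem_closedTrails.2 ⟨mem_closedWalks.2 hslot,
    fun i j h ↦ hφ (congrArg Prod.fst h), fun i j h ↦ add_one_add_one_ne_self hk i ?_⟩, fun _ ↦ rfl⟩
  have hij : i + 1 = j := hφ (by rw [← hslot i, h])
  have hji : j + 1 = i := hφ (by rw [← hslot j, ← h, hf])
  rw [hij, hji]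

lemma labelledCopyCount_eq_natCard {V W : Type*} [Fintype V] [Fintype W] (G : SimpleGraph V)
    (H : SimpleGraph W) : G.labelledCopyCount H = Nat.card (SimpleGraph.Copy H G) := by
  classical
  rw [Nat.card_eq_fintype_card]
  unfold SimpleGraph.labelledCopyCount
  congr

lemma labelledCopyCount_cycleGraph_le (hf : Function.Involutive f) {k : ℕ} (hk : 2 ≤ k) :
    (simpleGraphOf f).labelledCopyCount (SimpleGraph.cycleGraph (k + 1)) ≤ #(closedTrails f k) := by
  choose s hs hφ using exists_closedTrail_of_copy hf hk
  rw [labelledCopyCount_eq_natCard, ← Nat.card_eq_finsetCard]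
  refine Nat.card_le_card_of_injective (fun φ ↦ ⟨s φ, hs φ⟩) fun φ ψ h ↦
    DFunLike.ext _ _ fun i ↦ ?_
  have hs_eq : s φ = s ψ := congrArg Subtype.val h
  rw [← hφ, ← hφ, hs_eq]

lemma injDensity_nonneg {V W : Type*} [Fintype V] [Fintype W] (F : SimpleGraph W)
    (G : SimpleGraph V) {d : ℕ} (hd : 1 ≤ d) : 0 ≤ injDensity F G d := by
  have : (0 : ℝ) ≤ d - 1 := by simpa using hd
  unfold injDensity
  split_ifs <;> positivity

lemma injDensity_cycleGraph_le (hf : Function.Involutive f) (hd : 1 ≤ d) {k : ℕ} (hk : 2 ≤ k)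
    {δ : ℝ} (hδ : 0 ≤ δ) (h : #(closedTrails f k) ≤ δ * n * d ^ k) :
    injDensity (SimpleGraph.cycleGraph (k + 1)) (simpleGraphOf f) d ≤ δ * 2 ^ (k - 1) := by
  obtain ⟨l, rfl⟩ : ∃ l, k = l + 1 := ⟨k - 1, by omega⟩
  rw [injDensity, if_neg (by simp), Fintype.card_fin, Fintype.card_fin,
    show l + 1 + 1 - 2 = l by omega, Nat.add_sub_cancel]
  obtain rfl | hd2 : d = 1 ∨ 2 ≤ d := by omega
  · rw [Nat.cast_one, sub_self, zero_pow (by omega), mul_zero, div_zero]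
    positivity
  have hd1 : (2 : ℝ) ≤ d := mod_cast hd2
  have hd_sub : (0 : ℝ) ≤ d - 1 := by linarith
  refine div_le_of_le_mul₀ (by positivity) (by positivity) ?_
  calc ((simpleGraphOf f).labelledCopyCount (SimpleGraph.cycleGraph (l + 1 + 1)) : ℝ)
      ≤ #(closedTrails f (l + 1)) := mod_cast labelledCopyCount_cycleGraph_le hf hk
    _ ≤ δ * n * d * d ^ l := h.trans_eq (by ring)
    _ ≤ δ * n * d * (2 * (d - 1)) ^ l := by gcongr; linarith
    _ = δ * 2 ^ l * (n * d * (d - 1) ^ l) := by rw [mul_pow]; ring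

end SimpleGraphOf

section SparseMatchings

/-- A matching that leaves out at most one leg and has, for every `k ≤ l`, at most `δ * n * d ^ k`
closed trails of `k + 1` steps, out of about `n * d ^ (k + 1)` walks of `k + 1` steps. Both the
regularity and the large essential girth of graphs follow from having this with small `δ`. -/
structure IsSparseMatching {n d : ℕ} (l : ℕ) (δ : ℝ) (f : Leg n d → Leg n d) : Prop where
  involutive : Function.Involutive f
  card_fixed_le : #{x | f x = x} ≤ 1
  card_closedTrails_le : ∀ k ≤ l, #(closedTrails f k) ≤ δ * n * d ^ k

lemma IsSparseMatching.mono {n d l : ℕ} {δ δ' : ℝ} {f : Leg n d → Leg n d}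
    (hf : IsSparseMatching l δ f) (hδ : δ ≤ δ') : IsSparseMatching l δ' f :=
  ⟨hf.involutive, hf.card_fixed_le, fun k hk ↦ (hf.card_closedTrails_le k hk).trans (by gcongr)⟩

lemma IsSparseMatching.card_redundantLegs_le {n d : ℕ} {δ : ℝ} {f : Leg n d → Leg n d}
    (hf : IsSparseMatching 1 δ f) (hδ : 0 ≤ δ) (hd : 1 ≤ d) :
    #(redundantLegs f) ≤ (1 + 2 * δ * n) * d := by
  have hd1 : (1 : ℝ) ≤ d := mod_cast hd
  have hfixed : (#{x | f x = x} : ℝ) ≤ 1 := mod_cast hf.card_fixed_le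
  have hloops := hf.card_closedTrails_le 0 (Nat.zero_le 1)
  have hparallel := hf.card_closedTrails_le 1 le_rfl
  calc (#(redundantLegs f) : ℝ)
      ≤ #{x | f x = x} + #(closedTrails f 0) + #(closedTrails f 1) :=
        mod_cast GraphSeq.card_redundantLegs_le hf.involutive
    _ ≤ (1 + δ * n) * 1 + δ * n * d := by linarith
    _ ≤ (1 + δ * n) * d + δ * n * d := by gcongr
    _ = (1 + 2 * δ * n) * d := by ring

variable {d : ℕ → ℕ} {g : ∀ n, SimpleGraph (Fin n)}

lemma isRegularSeq_of_isSparseMatching (hd : ∀ n, 1 ≤ d n)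
    (hg : ∀ δ > 0, ∀ᶠ n in atTop, ∃ f : Leg n (d n) → Leg n (d n),
      IsSparseMatching 1 δ f ∧ simpleGraphOf f = g n) :
    IsRegularSeq 1 g d := by
  intro η hη
  refine tendsto_order.2 ⟨fun a ha ↦ .of_forall fun n ↦ ha.trans_le (by positivity),
    fun r hr ↦ ?_⟩
  have hδ : 0 < η * r / 4 := by positivity
  have hn_large : ∀ᶠ n : ℕ in atTop, 1 < η * r / 4 * n :=
    (tendsto_natCast_atTop_atTop.const_mul_atTop hδ).eventually_gt_atTop 1
  filter_upwards [hg _ hδ, hn_large] with n ⟨f, hf, hfg⟩ hn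
  have hn0 : (0 : ℝ) < n := pos_of_mul_pos_right (one_pos.trans hn) hδ.le
  have hd0 : (0 : ℝ) < d n := mod_cast hd n
  rw [← hfg, Fintype.card_fin, div_lt_iff₀ hn0]
  refine lt_of_mul_lt_mul_right ?_ (by positivity : 0 ≤ η * d n)
  calc _ ≤ (#(redundantLegs f) : ℝ) := ncard_irregular_mul_le hf.involutive (hd n) η
    _ ≤ (1 + 2 * (η * r / 4) * n) * d n := hf.card_redundantLegs_le hδ.le (hd n)
    _ < (η * r * n) * d n := by gcongr; linarith
    _ = r * n * (η * d n) := by ring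

lemma hasLargeEssentialGirth_of_isSparseMatching (hd : ∀ n, 1 ≤ d n)
    (hg : ∀ l, ∀ δ > 0, ∀ᶠ n in atTop, ∃ f : Leg n (d n) → Leg n (d n),
      IsSparseMatching l δ f ∧ simpleGraphOf f = g n) :
    HasLargeEssentialGirth g d := by
  intro l hl
  obtain ⟨k, rfl⟩ : ∃ k, l = k + 1 := ⟨l - 1, by omega⟩
  refine tendsto_order.2 ⟨fun a ha ↦ .of_forall fun n ↦ ha.trans_le (injDensity_nonneg _ _ (hd n)),
    fun r hr ↦ ?_⟩
  have hδ : 0 < r / 2 / 2 ^ (k - 1) := by positivity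
  filter_upwards [hg k _ hδ] with n ⟨f, hf, hfg⟩
  rw [← hfg]
  calc _ ≤ r / 2 / 2 ^ (k - 1) * 2 ^ (k - 1) := injDensity_cycleGraph_le hf.involutive (hd n)
        (by omega) hδ.le (hf.card_closedTrails_le k le_rfl)
    _ = r / 2 := div_mul_cancel₀ _ (by positivity)
    _ < r := half_lt_self hr

end SparseMatchings

section Probability

instance {V : Type*} [Finite V] : DiscreteMeasurableSpace (SimpleGraph V) := by
  have : MeasurableSingletonClass (SimpleGraph V) :=
    ⟨fun g ↦ ⟨{g.Adj}, MeasurableSet.singleton _, by ext h; simp [SimpleGraph.adj_inj]⟩⟩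
  infer_instance

lemma ae_eventually_notMem_of_eventually_measure_le {Ω : Type*} [MeasurableSpace Ω]
    {P : Measure Ω} [IsFiniteMeasure P] {s : ℕ → Set Ω} {b : ℕ → ℝ} (hb : Summable b)
    (hs : ∀ᶠ n in atTop, P (s n) ≤ ENNReal.ofReal (b n)) :
    ∀ᵐ ω ∂P, ∀ᶠ n in atTop, ω ∉ s n := by
  have hsum : Summable fun n ↦ P.real (s n) := by
    refine summable_of_isBigO_nat hb (IsBigO.of_bound 1 ?_)
    filter_upwards [hs] with n hn
    rw [one_mul, Real.norm_of_nonneg measureReal_nonneg]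
    refine ENNReal.toReal_le_of_le_ofReal (norm_nonneg _) (hn.trans ?_)
    exact ENNReal.ofReal_le_ofReal (Real.le_norm_self _)
  refine ae_eventually_notMem ?_
  simpa only [ofReal_measureReal (measure_ne_top _ _)] using hsum.tsum_ofReal_ne_top

lemma summable_of_isBigO_rpow_one_sub {ε : ℝ} {u : ℕ → ℝ}
    (hu : u =O[atTop] fun n : ℕ ↦ (n : ℝ) ^ (1 - ε)) {m : ℕ} (hm : 1 < ε * m) :
    Summable fun n : ℕ ↦ (u n / n) ^ m := by
  refine summable_of_isBigO_nat (Real.summable_nat_rpow.2 (neg_lt_neg hm))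
    (((hu.mul (isBigO_refl (fun n : ℕ ↦ (n : ℝ)⁻¹) _)).pow m).trans (EventuallyEq.isBigO ?_))
  filter_upwards [eventually_ge_atTop 1] with n hn
  have hn0 : (0 : ℝ) < n := mod_cast hn
  rw [← Real.rpow_neg_one, ← Real.rpow_add hn0, ← Real.rpow_natCast, ← Real.rpow_mul hn0.le]
  congr 1
  ring

section Law

variable {n d : ℕ} {ν : PMF (Finset (Leg n d))}

lemma uniformOn_legMatchings_le {S : Finset (Leg n d)} {p : (Leg n d → Leg n d) → Prop}
    [DecidablePred p] {b : ℝ} (hb : 0 ≤ b)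
    (h : #{f ∈ matchings S | p f} ≤ b * #(matchings S)) :
    uniformOn (legMatchings n d S) {f | p f} ≤ ENNReal.ofReal b := by
  have hcoe : legMatchings n d S = matchings S := by
    ext f
    exact mem_matchings.symm
  have hinter : (matchings S : Set (Leg n d → Leg n d)) ∩ {f | p f} =
      ({f ∈ matchings S | p f} : Finset _) := by
    ext f
    simp
  rw [hcoe, ← uniformOn_inter_self (Finset.finite_toSet _), hinter, uniformOn_apply_finset,
    Finset.inter_eq_right.2 (Finset.filter_subset _ _)]
  refine ENNReal.div_le_of_le_mul ?_
  rw [← ENNReal.ofReal_natCast, ← ENNReal.ofReal_natCast, ← ENNReal.ofReal_mul hb]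
  exact ENNReal.ofReal_le_ofReal h

lemma simpleConfigurationLaw_apply_le {A : Set (SimpleGraph (Fin n))} {c : ENNReal}
    (h : ∀ S ∈ ν.support, uniformOn (legMatchings n d S) (simpleGraphOf ⁻¹' A) ≤ c) :
    simpleConfigurationLaw n d ν A ≤ c := by
  have hν : ∑ S, ν S = 1 := (tsum_fintype _).symm.trans ν.tsum_coe
  rw [simpleConfigurationLaw, Measure.map_apply .of_discrete .of_discrete, configurationLaw,
    Measure.finsetSum_apply]
  calc ∑ S, ν S * uniformOn (legMatchings n d S) (simpleGraphOf ⁻¹' A) ≤ ∑ S, ν S * c := by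
        refine Finset.sum_le_sum fun S _ ↦ ?_
        by_cases hS : ν S = 0
        · simp [hS]
        · exact mul_le_mul_right (h S ((ν.mem_support_iff S).2 hS)) _
    _ = c := by rw [← Finset.sum_mul, hν, one_mul]

lemma simpleConfigurationLaw_not_admissible (hd : 1 ≤ d) :
    simpleConfigurationLaw n d ν {g | ¬ Admissible g d} = 0 := by
  refine le_antisymm (simpleConfigurationLaw_apply_le fun S _ ↦ ?_) zero_le
  refine ((uniformOn_eq_zero_iff (Set.toFinite _)).2 ?_).le
  exact Set.eq_empty_of_forall_notMem fun f ⟨hf, hbad⟩ ↦ hbad (admissible_simpleGraphOf hf.1 hd)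

lemma card_many_closedTrails_le {S : Finset (Leg n d)} (hS : #S ≤ 1) (hd : 1 ≤ d) {k m : ℕ}
    {δ : ℝ} (hδ : 0 < δ) (hn : 4 * ((k + 1) * m) + 2 ≤ n)
    (hn' : 4 * (k + 1) * ((k + 1) * m) ≤ δ * n) :
    #{f ∈ matchings S | δ * n * d ^ k ≤ #(closedTrails f k)} ≤
      (2 ^ (k + 2) / δ) ^ m * (d / n : ℝ) ^ m * #(matchings S) := by
  have hn0 : (0 : ℝ) < n := mod_cast (by omega : 0 < n)
  have hnd : n ≤ n * d := Nat.le_mul_of_pos_right n hd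
  have key := card_many_closedTrails_mul_pow_le (S := S) (t := δ * n / 2) (m := m) (k := k)
    (by omega) (by omega) (by linarith)
  rw [mul_div_cancel₀ _ two_ne_zero, ← le_div_iff₀ (by positivity)] at key
  refine key.trans_eq ?_
  rw [mul_div_right_comm, ← div_pow, ← mul_pow]
  congr 2
  field_simp
  ring

open Classical in
lemma card_not_isSparseMatching_le {S : Finset (Leg n d)} (hS : #S ≤ 1) (hd : 1 ≤ d) {l m : ℕ}
    {δ : ℝ} (hδ : 0 < δ) (hn : 4 * ((l + 1) * m) + 2 ≤ n)
    (hn' : 4 * (l + 1) * ((l + 1) * m) ≤ δ * n) :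
    #{f ∈ matchings S | ¬ IsSparseMatching l δ f} ≤
      (∑ k ∈ Finset.range (l + 1), (2 ^ (k + 2) / δ) ^ m) * (d / n : ℝ) ^ m * #(matchings S) := by
  have hsub : ({f ∈ matchings S | ¬ IsSparseMatching l δ f} : Finset _) ⊆
      (Finset.range (l + 1)).biUnion fun k ↦
        {f ∈ matchings S | δ * n * d ^ k ≤ #(closedTrails f k)} := fun f hf ↦ by
    obtain ⟨hf, hdense⟩ := Finset.mem_filter.1 hf
    have hfS := mem_matchings.1 hf
    by_contra hnone
    simp only [Finset.mem_biUnion, Finset.mem_range, Finset.mem_filter, hf, true_and, not_exists,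
      not_and, not_le] at hnone
    refine hdense ⟨hfS.1, ?_, fun k hk ↦ (hnone k (by omega)).le⟩
    simpa only [hfS.2, Finset.filter_univ_mem] using hS
  have hunion := (Finset.card_le_card hsub).trans Finset.card_biUnion_le
  calc (#{f ∈ matchings S | ¬ IsSparseMatching l δ f} : ℝ)
      ≤ ∑ k ∈ Finset.range (l + 1),
          (#{f ∈ matchings S | δ * n * d ^ k ≤ #(closedTrails f k)} : ℝ) :=
        (Nat.cast_le.2 hunion).trans_eq (Nat.cast_sum _ _)
    _ ≤ ∑ k ∈ Finset.range (l + 1), (2 ^ (k + 2) / δ) ^ m * (d / n : ℝ) ^ m * #(matchings S) := by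
        refine Finset.sum_le_sum fun k hk ↦ ?_
        have hkl : k ≤ l := Finset.mem_range_succ_iff.1 hk
        have hkl' : (k : ℝ) ≤ l := mod_cast hkl
        refine card_many_closedTrails_le hS hd hδ (le_trans (by gcongr) hn) (le_trans ?_ hn')
        gcongr
    _ = _ := by rw [← Finset.sum_mul, ← Finset.sum_mul]

lemma simpleConfigurationLaw_not_isSparseMatching_le (hν : LeavesOutParity ν) (hd : 1 ≤ d)
    {l m : ℕ} {δ : ℝ} (hδ : 0 < δ) (hn : 4 * ((l + 1) * m) + 2 ≤ n)
    (hn' : 4 * (l + 1) * ((l + 1) * m) ≤ δ * n) :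
    simpleConfigurationLaw n d ν
        {g | ¬ ∃ f : Leg n d → Leg n d, IsSparseMatching l δ f ∧ simpleGraphOf f = g} ≤
      ENNReal.ofReal ((∑ k ∈ Finset.range (l + 1), (2 ^ (k + 2) / δ) ^ m) * (d / n : ℝ) ^ m) := by
  classical
  refine simpleConfigurationLaw_apply_le fun S hS ↦ ?_
  have hS1 : #S ≤ 1 := by
    have := hν S hS
    omega
  have hsub : simpleGraphOf ⁻¹'
      {g | ¬ ∃ f : Leg n d → Leg n d, IsSparseMatching l δ f ∧ simpleGraphOf f = g} ⊆
      {f | ¬ IsSparseMatching l δ f} := fun f hf hsparse ↦ hf ⟨f, hsparse, rfl⟩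
  exact (measure_mono hsub).trans
    (uniformOn_legMatchings_le (by positivity) (card_not_isSparseMatching_le hS1 hd hδ hn hn'))

end Law

variable {d : ℕ → ℕ} {ν : ∀ n, PMF (Finset (Leg n (d n)))} {Ω : Type*} [MeasurableSpace Ω]
  {P : Measure Ω} {G : ∀ n, Ω → SimpleGraph (Fin n)}

lemma ae_admissible (hd_pos : ∀ n, 1 ≤ d n)
    (hG : ∀ n, HasLaw (G n) (simpleConfigurationLaw n (d n) (ν n)) P) :
    ∀ᵐ ω ∂P, ∀ n, Admissible (G n ω) (d n) := by
  refine ae_all_iff.2 fun n ↦ ?_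
  rw [ae_iff, (hG n).measure_eq (p := fun g ↦ ¬ Admissible g (d n)) .of_discrete]
  exact simpleConfigurationLaw_not_admissible (hd_pos n)

variable [IsFiniteMeasure P] {ε : ℝ}

lemma ae_eventually_exists_isSparseMatching (hε : 0 < ε) (hd_pos : ∀ n, 1 ≤ d n)
    (hd : (fun n ↦ (d n : ℝ)) =O[atTop] fun n : ℕ ↦ (n : ℝ) ^ (1 - ε))
    (hν : ∀ n, LeavesOutParity (ν n))
    (hG : ∀ n, HasLaw (G n) (simpleConfigurationLaw n (d n) (ν n)) P)
    (l : ℕ) {δ : ℝ} (hδ : 0 < δ) :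
    ∀ᵐ ω ∂P, ∀ᶠ n in atTop, ∃ f : Leg n (d n) → Leg n (d n),
      IsSparseMatching l δ f ∧ simpleGraphOf f = G n ω := by
  obtain ⟨m, hm⟩ := exists_nat_gt (1 / ε)
  rw [div_lt_iff₀' hε] at hm
  have hn_large : ∀ᶠ n : ℕ in atTop, 4 * (l + 1) * ((l + 1) * m) ≤ δ * n :=
    (tendsto_natCast_atTop_atTop.const_mul_atTop hδ).eventually_ge_atTop _
  have key := ae_eventually_notMem_of_eventually_measure_le (P := P)
    (s := fun n ↦ {ω | ¬ ∃ f : Leg n (d n) → Leg n (d n),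
      IsSparseMatching l δ f ∧ simpleGraphOf f = G n ω})
    ((summable_of_isBigO_rpow_one_sub hd hm).mul_left
      (∑ k ∈ Finset.range (l + 1), (2 ^ (k + 2) / δ) ^ m)) ?_
  · simpa only [Set.mem_ofPred_eq, not_not] using key
  · filter_upwards [eventually_ge_atTop (4 * ((l + 1) * m) + 2), hn_large] with n hn hn'
    rw [(hG n).measure_eq (p := fun g ↦ ¬ ∃ f : Leg n (d n) → Leg n (d n),
      IsSparseMatching l δ f ∧ simpleGraphOf f = g) .of_discrete]
    exact simpleConfigurationLaw_not_isSparseMatching_le (hν n) (hd_pos n) hδ hn hn'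

lemma ae_forall_eventually_exists_isSparseMatching (hε : 0 < ε) (hd_pos : ∀ n, 1 ≤ d n)
    (hd : (fun n ↦ (d n : ℝ)) =O[atTop] fun n : ℕ ↦ (n : ℝ) ^ (1 - ε))
    (hν : ∀ n, LeavesOutParity (ν n))
    (hG : ∀ n, HasLaw (G n) (simpleConfigurationLaw n (d n) (ν n)) P) :
    ∀ᵐ ω ∂P, ∀ l, ∀ δ > 0, ∀ᶠ n in atTop, ∃ f : Leg n (d n) → Leg n (d n),
      IsSparseMatching l δ f ∧ simpleGraphOf f = G n ω := by
  have hsparse := ae_all_iff.2 fun l : ℕ ↦ ae_all_iff.2 fun j : ℕ ↦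
    ae_eventually_exists_isSparseMatching hε hd_pos hd hν hG l (δ := 1 / ((j : ℝ) + 1))
      Nat.one_div_pos_of_nat
  filter_upwards [hsparse] with ω hω l δ hδ
  obtain ⟨j, hj⟩ := exists_nat_one_div_lt hδ
  exact (hω l j).mono fun n ⟨f, hf, hfG⟩ ↦ ⟨f, hf.mono hj.le, hfG⟩

end Probability

end GraphSeq

theorem mainTheorem11 (ε : ℝ) (hε : 0 < ε) (d : ℕ → ℕ) (hd_pos : ∀ n, 1 ≤ d n)
    (hd : (fun n : ℕ ↦ (d n : ℝ)) =O[atTop] (fun n : ℕ ↦ (n : ℝ) ^ (1 - ε)))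
    (ν : ∀ n, PMF (Finset (GraphSeq.Leg n (d n))))
    (hν : ∀ n, GraphSeq.LeavesOutParity (ν n))
    {Ω : Type*} [MeasurableSpace Ω] (P : Measure Ω) [IsProbabilityMeasure P]
    (G : ∀ n, Ω → SimpleGraph (Fin n))
    (hG : ∀ n, HasLaw (G n) (GraphSeq.simpleConfigurationLaw n (d n) (ν n)) P) :
    ∀ᵐ ω ∂P,
      (∀ n, GraphSeq.Admissible (G n ω) (d n)) ∧
      GraphSeq.IsRegularSeq 1 (fun n ↦ G n ω) d ∧
      GraphSeq.HasLargeEssentialGirth (fun n ↦ G n ω) d := by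
  filter_upwards [GraphSeq.ae_admissible hd_pos hG,
    GraphSeq.ae_forall_eventually_exists_isSparseMatching hε hd_pos hd hν hG]
    with ω hadmissible hsparse
  exact ⟨hadmissible, GraphSeq.isRegularSeq_of_isSparseMatching hd_pos (hsparse 1),
    GraphSeq.hasLargeEssentialGirth_of_isSparseMatching hd_pos hsparse⟩
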